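/- Let $\mathbb K\in\{\mathbb R,\mathbb C\}$ and let $X$ be a quojection over $\mathbb K$, i.e. a topological vector space (linearly homeomorphic to) $$X=\Big\{(x_n)_n\in\prod_{n\in\mathbb N}X_n:\ \pi^n_m(x_m)=x_n\text{ for all }n\le m\Big\}$$ with the topology induced by the product topology, where the $X_n$ are Banach spaces and $\pi^n_m:X_m\to X_n$ ($n\le m$) are surjective continuous linear maps with $\pi^n_n=\mathrm{id}$ and $\pi^n_m\circ\pi^m_k=\pi^n_k$ for $n\le m\le k$. Fix such a representation, with canonical maps $\pi_n:X\to X_n$, and let $L(X)$ be the set of continuous linear operators on $X$. A strongly continuous semigroup $T=(T_t)_{t\ge0}$ on $X$ is a family in $L(X)$ with $T_0=\mathrm{id}$, $T_{s+t}=T_s\circ T_t$ and continuous orbits $t\mapsto T_t(x)$ for all $x\in X$; it is uniformly continuous if $T_t\to\mathrm{id}$ as $t\to0$ uniformly on bounded subsets of $X$. Its generator $(A,D(A))$ is given by $A(x)=\lim_{h\downarrow0}\frac1h(T_h(x)-x)$ on the set $D(A)$ of all $x\in X$ for which this limit exists; we say that $A\in L(X)$ generates $T$ if the generator of $T$ is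 $(A,X)$. (1) If $T$ is a uniformly continuous semigroup on $X$, then its generator $A$ is defined on all of $X$ and continuous, and for all $x\in X$ and $t\ge0$ $$T_t(x)=\sum_{k=0}^\infty\frac{t^k}{k!}A^k(x).$$ (2) An operator $A\in L(X)$ generates a strongly continuous semigroup on $X$ if and only if for every $n\in\mathbb N$ there is $m\in\mathbb N$ such that for all $k\in\mathbb N_0$ and all $x\in X$: $\pi_m(x)=0$ implies $\pi_n(A^k(x))=0$. In this case the generated semigroup is even uniformly continuous. -/

import Mathlib

open Filter Topology
open scoped NNReal Nat

universe u v

section ProjectiveLimit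

variable {𝕜 : Type u} [RCLike 𝕜] {E : ℕ → Type v}
  [∀ n, NormedAddCommGroup (E n)] [∀ n, NormedSpace 𝕜 (E n)]

/-- The linking maps `link : E m → E n`, for `n ≤ m`, form a strict projective system:
they are functorial and surjective. -/
structure IsStrictProjSystem (link : ∀ n m : ℕ, n ≤ m → (E m →L[𝕜] E n)) : Prop where
  map_id : ∀ n, link n n le_rfl = ContinuousLinearMap.id 𝕜 (E n)
  map_comp : ∀ (n m k : ℕ) (hnm : n ≤ m) (hmk : m ≤ k),
    (link n m hnm).comp (link m k hmk) = link n k (hnm.trans hmk)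
  surj : ∀ (n m : ℕ) (hnm : n ≤ m), Function.Surjective (link n m hnm)

/-- The projective limit: the subspace of all compatible sequences in the product `∏ n, E n`;
as a type it carries the subspace topology of the product topology. -/
def projLim (link : ∀ n m : ℕ, n ≤ m → (E m →L[𝕜] E n)) : Submodule 𝕜 (∀ n, E n) where
  carrier := {x | ∀ (n m : ℕ) (h : n ≤ m), link n m h (x m) = x n}
  add_mem' := by
    intro x y hx hy n m h
    simp [hx n m h, hy n m h]
  zero_mem' := by
    intro n m h
    simp
  smul_mem' := by
    intro c x hx n m h
    simp [hx n m h]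

end ProjectiveLimit

section Semigroups

variable (𝕜 : Type u) [RCLike 𝕜] (X : Type v) [AddCommGroup X] [Module 𝕜 X]
  [TopologicalSpace X]

/-- A strongly continuous one-parameter semigroup of continuous linear operators on `X`. -/
structure StronglyContSemigroup where
  /-- the operators `T_t`, `t ≥ 0` -/
  op : ℝ≥0 → (X →L[𝕜] X)
  op_zero : op 0 = ContinuousLinearMap.id 𝕜 X
  op_add : ∀ s t, op (s + t) = (op s).comp (op t)
  continuous_orbit : ∀ x, Continuous fun t => op t x

variable {𝕜 X}

namespace StronglyContSemigroup

/-- `T_t → id` as `t → 0`, uniformly on every (von Neumann) bounded subset of `X`. -/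
def IsUniformlyCont (T : StronglyContSemigroup 𝕜 X) : Prop :=
  ∀ B : Set X, Bornology.IsVonNBounded 𝕜 B →
    ∀ U ∈ 𝓝 (0 : X), ∀ᶠ t in 𝓝 (0 : ℝ≥0), ∀ x ∈ B, T.op t x - x ∈ U

/-- The orbit of `x` has the right derivative `y` at `0`. -/
def HasOrbitDeriv (T : StronglyContSemigroup 𝕜 X) (x y : X) : Prop :=
  Tendsto (fun h : ℝ≥0 => (((h : ℝ) : 𝕜))⁻¹ • (T.op h x - x)) (𝓝[>] 0) (𝓝 y)

theorem HasOrbitDeriv.add [IsTopologicalAddGroup X] {T : StronglyContSemigroup 𝕜 X} {x y x' y' : X}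
    (h : T.HasOrbitDeriv x y) (h' : T.HasOrbitDeriv x' y') :
    T.HasOrbitDeriv (x + x') (y + y') := by
  refine (Tendsto.add h h').congr fun t => ?_
  rw [← smul_add, map_add]
  congr 1
  abel

theorem HasOrbitDeriv.smul [ContinuousSMul 𝕜 X] {T : StronglyContSemigroup 𝕜 X} {x y : X} (c : 𝕜)
    (h : T.HasOrbitDeriv x y) : T.HasOrbitDeriv (c • x) (c • y) := by
  refine (Tendsto.const_smul h c).congr fun t => ?_
  rw [map_smul, ← smul_sub, smul_comm]

variable [IsTopologicalAddGroup X] [ContinuousSMul 𝕜 X]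

/-- The infinitesimal generator `(A, D(A))`: the derivative at `0` of the orbits, on the domain of
all `x` for which this derivative exists. -/
noncomputable def generator [T2Space X] (T : StronglyContSemigroup 𝕜 X) : X →ₗ.[𝕜] X where
  domain :=
    { carrier := {x | ∃ y, T.HasOrbitDeriv x y}
      add_mem' := fun ⟨y, hy⟩ ⟨y', hy'⟩ => ⟨y + y', hy.add hy'⟩
      zero_mem' := ⟨0, by simp [HasOrbitDeriv]⟩
      smul_mem' := fun c _ ⟨y, hy⟩ => ⟨c • y, hy.smul c⟩ }
  toFun :=
    { toFun := fun x => Classical.choose x.2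
      map_add' := fun x x' => tendsto_nhds_unique (Classical.choose_spec (x + x').2)
        ((Classical.choose_spec x.2).add (Classical.choose_spec x'.2))
      map_smul' := fun c x => tendsto_nhds_unique (Classical.choose_spec (c • x).2)
        ((Classical.choose_spec x.2).smul c) }

/-- The everywhere defined continuous operator `A` is the generator of `T`
(equality of partially defined operators, so the generator has domain `X`). -/
def IsGeneratedBy [T2Space X] (T : StronglyContSemigroup 𝕜 X) (A : X →L[𝕜] X) : Prop :=
  T.generator = (A : X →ₗ[𝕜] X).toPMap ⊤

end StronglyContSemigroup

end Semigroups

/-! Two facts are used throughout. A quojection is a Baire space, so a strongly continuous semigroup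
is locally equicontinuous (`exists_orbit_bound`): coordinate `n` of the orbit on `[0, R]` is bounded
by one coordinate norm `m`, hence depends only on `p m x`. By the open mapping theorem, elements of
`E n` lift to `X` with norm control in every coordinate (`exists_lift`), which replaces the missing
norm of `X`.

If `A` generates `T` and `p m x = 0`, then coordinate `n` of the orbit vanishes for small times, and
so do its derivatives `p n (A ^ k x)`. Conversely, the kernel condition allows replacing an element
by a controlled lift of its coordinate `m` before each application of `A`; this yields exponential
growth of the powers (`exists_pow_bound`), and the exponential series defines the semigroup.
Taylor's formula gives uniform continuity and identifies every semigroup generated by `A` with its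
series.

For uniformly continuous `T` it remains to show that the domain is everything. The means of orbits
over `[0, δ]` lie in the domain. For small `δ` they induce, in coordinate `n`, a small perturbation
of the surjection `E m → E n`, which is still surjective. Thus each `x` agrees in any given
coordinate with an element of the domain, and by equicontinuity its difference quotients converge in
every coordinate. -/

/-- A bound for a linear map on a seminorm ball gives a bound by the seminorm. -/
theorem norm_le_of_ball_bound {𝕜 : Type*} [RCLike 𝕜]
    {X : Type*} [AddCommGroup X] [Module 𝕜 X] {F G : Type*} [NormedAddCommGroup F] [NormedSpace 𝕜 F]
    [NormedAddCommGroup G] [NormedSpace 𝕜 G] (q : X →ₗ[𝕜] G) (f : X →ₗ[𝕜] F) {ε c : ℝ} (hε : 0 < ε)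
    (h : ∀ x, ‖q x‖ < ε → ‖f x‖ ≤ c) (x : X) : ‖f x‖ ≤ 2 * c / ε * ‖q x‖ := by
  -- `‖q x‖` may vanish, so `x` is rescaled by a number `r` strictly above it; then `r` decreases to
  -- `‖q x‖`.
  have key : ∀ r : ℝ, ‖q x‖ < r → ‖f x‖ ≤ 2 * c / ε * r := by
    intro r hr
    have hr0 : 0 < r := (norm_nonneg _).trans_lt hr
    have hs : 0 < ε / (2 * r) := by positivity
    have h1 := h (((ε / (2 * r) : ℝ) : 𝕜) • x) (by
      rw [map_smul, norm_smul, RCLike.norm_ofReal, abs_of_pos hs]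
      calc ε / (2 * r) * ‖q x‖ ≤ ε / (2 * r) * r := by gcongr
        _ = ε / 2 := by field_simp
        _ < ε := by linarith)
    rw [map_smul, norm_smul, RCLike.norm_ofReal, abs_of_pos hs] at h1
    calc ‖f x‖ = (ε / (2 * r) * ‖f x‖) * (2 * r / ε) := by field_simp
      _ ≤ c * (2 * r / ε) := by gcongr
      _ = 2 * c / ε * r := by ring
  have hlim : Tendsto (fun r : ℝ => 2 * c / ε * r) (𝓝[>] ‖q x‖) (𝓝 (2 * c / ε * ‖q x‖)) :=
    ((continuous_const.mul continuous_id).tendsto _).mono_left nhdsWithin_le_nhds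
  exact ge_of_tendsto hlim (eventually_nhdsWithin_of_forall fun r hr => key r hr)

/-! ### Quojections described by their coordinate maps -/

section QuojectionMaps

variable {𝕜 : Type*} [RCLike 𝕜] {E : ℕ → Type*}
  [∀ n, NormedAddCommGroup (E n)] [∀ n, NormedSpace 𝕜 (E n)]
  {X : Type*} [AddCommGroup X] [Module 𝕜 X] [TopologicalSpace X]

/-- The maps `p n : X → E n` represent `X` as the projective limit of the spaces `E n`, in such a
way that elements of each `E n` have preimages that are bounded in all coordinates. -/
structure IsQuojection (p : ∀ n, X →L[𝕜] E n) : Prop where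
  isInducing : IsInducing fun (x : X) n => p n x
  ext : ∀ x y, (∀ n, p n x = p n y) → x = y
  factor : ∀ n m, n ≤ m → ∃ L : E m →L[𝕜] E n, ∀ x, p n x = L (p m x)
  lift : ∀ n, ∃ K : ℕ → ℝ, ∀ v : E n, ∃ x, p n x = v ∧ ∀ l, ‖p l x‖ ≤ K l * ‖v‖
  glue : ∀ v : ∀ n, E n,
    (∀ n m (L : E m →L[𝕜] E n), (∀ x, p n x = L (p m x)) → L (v m) = v n) → ∃ x, ∀ n, p n x = v n

namespace IsQuojection

variable {p : ∀ n, X →L[𝕜] E n}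

theorem tendsto_iff (hp : IsQuojection p) {α : Type*} {l : Filter α} {f : α → X} {x : X} :
    Tendsto f l (𝓝 x) ↔ ∀ n, Tendsto (fun a => p n (f a)) l (𝓝 (p n x)) := by
  rw [hp.isInducing.tendsto_nhds_iff, tendsto_pi_nhds]
  rfl

theorem hasSum_iff (hp : IsQuojection p) {α : Type*} {f : α → X} {x : X} :
    HasSum f x ↔ ∀ n, HasSum (fun a => p n (f a)) (p n x) := by
  simp only [HasSum, hp.tendsto_iff, map_sum]

theorem norm_le (hp : IsQuojection p) {n m : ℕ} (h : n ≤ m) :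
    ∃ C, 0 ≤ C ∧ ∀ x, ‖p n x‖ ≤ C * ‖p m x‖ := by
  obtain ⟨L, hL⟩ := hp.factor n m h
  exact ⟨‖L‖, norm_nonneg _, fun x => by rw [hL]; exact L.le_opNorm _⟩

/-- A neighbourhood restricts finitely many coordinates only, and any later coordinate dominates
them all. -/
theorem exists_ball_subset (hp : IsQuojection p) {U : Set X} {x₀ : X} (hU : U ∈ 𝓝 x₀) (k : ℕ) :
    ∃ m, k ≤ m ∧ ∃ ε, 0 < ε ∧ ∀ x, ‖p m (x - x₀)‖ < ε → x ∈ U := by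
  rw [hp.isInducing.nhds_eq_comap, mem_comap, nhds_pi] at hU
  obtain ⟨V, hV, hVU⟩ := hU
  obtain ⟨I, hI, t, ht, htV⟩ := Filter.mem_pi.1 hV
  have hball : ∀ i, ∃ ε, 0 < ε ∧ ∀ v, ‖v - p i x₀‖ < ε → v ∈ t i := by
    intro i
    obtain ⟨ε, h0, h⟩ := Metric.mem_nhds_iff.1 (ht i)
    exact ⟨ε, h0, fun v hv => h (by rwa [Metric.mem_ball, dist_eq_norm])⟩
  choose δ hδ0 hδ using hball
  have hsub : ∀ s : Finset ℕ, ∃ m, k ≤ m ∧ ∃ ε, 0 < ε ∧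
      ∀ x, ‖p m (x - x₀)‖ < ε → ∀ i ∈ s, p i x ∈ t i := by
    intro s
    refine ⟨k + s.sup id, by omega, ?_⟩
    have hn : ∀ i ∈ s, ∃ C, 0 ≤ C ∧ ∀ x, ‖p i x‖ ≤ C * ‖p (k + s.sup id) x‖ := fun i hi =>
      hp.norm_le ((Finset.le_sup (f := id) hi).trans (Nat.le_add_left _ _))
    -- The index is frozen, so that the induction on `s` shrinks only the radius.
    generalize k + s.sup id = m at hn ⊢
    induction s using Finset.induction_on with
    | empty => exact ⟨1, one_pos, by simp⟩
    | insert a s ha ih =>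
      obtain ⟨ε, hε, h⟩ := ih fun i hi => hn i (Finset.mem_insert_of_mem hi)
      obtain ⟨C, hC, hCx⟩ := hn a (Finset.mem_insert_self _ _)
      refine ⟨min ε (δ a / (C + 1)), lt_min hε (div_pos (hδ0 a) (by linarith)), ?_⟩
      intro x hx i hi
      rcases Finset.mem_insert.1 hi with rfl | hi
      · apply hδ
        rw [← map_sub]
        have h2 := (lt_div_iff₀ (by linarith : 0 < C + 1)).1 (hx.trans_le (min_le_right _ _))
        nlinarith [hCx (x - x₀), norm_nonneg (p m (x - x₀))]
      · exact h x (hx.trans_le (min_le_left _ _)) i hi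
  obtain ⟨m, hkm, ε, hε, h⟩ := hsub hI.toFinset
  exact ⟨m, hkm, ε, hε, fun x hx => hVU (htV fun i hi => h x hx i (by simpa using hi))⟩

/-- A continuous linear map into a normed space is bounded by some coordinate norm. -/
theorem exists_bound (hp : IsQuojection p) {F : Type*} [NormedAddCommGroup F] [NormedSpace 𝕜 F]
    (f : X →L[𝕜] F) (k : ℕ) : ∃ m, k ≤ m ∧ ∃ C, 0 ≤ C ∧ ∀ x, ‖f x‖ ≤ C * ‖p m x‖ := by
  have hU : {x | ‖f x‖ < 1} ∈ 𝓝 (0 : X) := by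
    have : Tendsto (fun x => ‖f x‖) (𝓝 0) (𝓝 0) := by
      have := (f.continuous.norm).tendsto 0
      simpa using this
    exact this.eventually_lt_const one_pos
  obtain ⟨m, hkm, ε, hε, h⟩ := hp.exists_ball_subset hU k
  refine ⟨m, hkm, 2 * 1 / ε, by positivity, fun x => ?_⟩
  exact norm_le_of_ball_bound (p m).toLinearMap f.toLinearMap hε
    (fun y hy => (h y (by simpa using hy)).le) x

theorem continuous_of_bound [IsTopologicalAddGroup X] (hp : IsQuojection p) (f : X →ₗ[𝕜] X)
    (h : ∀ n, ∃ m C, ∀ x, ‖p n (f x)‖ ≤ C * ‖p m x‖) : Continuous f := by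
  apply continuous_of_continuousAt_zero f
  rw [ContinuousAt, hp.tendsto_iff]
  intro n
  obtain ⟨m, C, hC⟩ := h n
  rw [map_zero, map_zero]
  refine squeeze_zero_norm hC ?_
  have : Continuous fun x => C * ‖p m x‖ := by fun_prop
  simpa using this.tendsto 0

theorem bounded_of_isVonNBounded (_ : IsQuojection p) {B : Set X}
    (hB : Bornology.IsVonNBounded 𝕜 B) (n : ℕ) : ∃ R, 0 ≤ R ∧ ∀ x ∈ B, ‖p n x‖ ≤ R := by
  have h := hB.image (p n)
  rw [NormedSpace.isVonNBounded_iff, Metric.isBounded_iff_subset_closedBall 0] at h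
  obtain ⟨R, hR⟩ := h
  refine ⟨max R 0, le_max_right _ _, fun x hx => ?_⟩
  have := hR ⟨x, hx, rfl⟩
  rw [mem_closedBall_zero_iff] at this
  exact this.trans (le_max_left _ _)

theorem isVonNBounded_of_bounded (hp : IsQuojection p) {B : Set X} (K : ℕ → ℝ)
    (hB : ∀ x ∈ B, ∀ n, ‖p n x‖ ≤ K n) : Bornology.IsVonNBounded 𝕜 B := by
  intro U hU
  obtain ⟨m, -, ε, hε, h⟩ := hp.exists_ball_subset hU 0
  rw [absorbs_iff_norm]
  refine ⟨(|K m| + 1) / ε, fun c hc x hx => ?_⟩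
  have hc0 : 0 < ‖c‖ := lt_of_lt_of_le (by positivity) hc
  rw [Set.mem_smul_set_iff_inv_smul_mem₀ (norm_pos_iff.1 hc0)]
  apply h
  rw [sub_zero, map_smul, norm_smul, norm_inv, inv_mul_lt_iff₀ hc0]
  have h1 := (div_le_iff₀ hε).1 hc
  have := hB x hx m
  linarith [le_abs_self (K m)]

theorem surjective (hp : IsQuojection p) (n : ℕ) : Function.Surjective (p n) := fun v => by
  obtain ⟨K, hK⟩ := hp.lift n
  obtain ⟨x, hx, -⟩ := hK v
  exact ⟨x, hx⟩

/-- A continuous linear map that is bounded by a coordinate norm factors through the coordinate. -/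
theorem exists_factor (hp : IsQuojection p) {F : Type*} [NormedAddCommGroup F] [NormedSpace 𝕜 F]
    (f : X →L[𝕜] F) {m : ℕ} {C : ℝ} (h : ∀ x, ‖f x‖ ≤ C * ‖p m x‖) :
    ∃ L : E m →L[𝕜] F, ∀ x, L (p m x) = f x := by
  have hs := hp.surjective m
  have hw : ∀ x y, p m x = p m y → f x = f y := by
    intro x y hxy
    have := h (x - y)
    rw [map_sub, map_sub, hxy, sub_self, norm_zero, mul_zero] at this
    exact sub_eq_zero.1 (norm_le_zero_iff.1 this)
  have hg := Function.surjInv_eq hs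
  refine ⟨LinearMap.mkContinuous
    { toFun := fun v => f (Function.surjInv hs v)
      map_add' := fun v w => by rw [← map_add]; exact hw _ _ (by simp [hg])
      map_smul' := fun c v => by
        rw [RingHom.id_apply, ← map_smul]; exact hw _ _ (by simp [hg]) } C ?_, ?_⟩
  · intro v
    simpa [hg] using h (Function.surjInv hs v)
  · intro x
    exact hw _ _ (hg _)

/-- Uniform boundedness: a pointwise bounded family is bounded by a single coordinate norm. -/
theorem banach_steinhaus [BaireSpace X] (hp : IsQuojection p)
    {F : Type*} [NormedAddCommGroup F] [NormedSpace 𝕜 F] {ι : Type*} (f : ι → X →L[𝕜] F)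
    (h : ∀ x, ∃ c : ℝ, ∀ i, ‖f i x‖ ≤ c) (k : ℕ) :
    ∃ m, k ≤ m ∧ ∃ C, 0 ≤ C ∧ ∀ i x, ‖f i x‖ ≤ C * ‖p m x‖ := by
  have hcl : ∀ c : ℕ, IsClosed {x | ∀ i, ‖f i x‖ ≤ c} := fun c => by
    simp only [Set.ofPred_forall]
    exact isClosed_iInter fun i => isClosed_le (by fun_prop) continuous_const
  obtain ⟨c, x₀, hx₀⟩ := nonempty_interior_of_iUnion_of_closed hcl (by
    refine Set.eq_univ_of_forall fun x => Set.mem_iUnion.2 ?_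
    obtain ⟨c, hc⟩ := h x
    obtain ⟨N, hN⟩ := exists_nat_ge c
    exact ⟨N, fun i => (hc i).trans hN⟩)
  obtain ⟨m, hkm, ε, hε, hm⟩ := hp.exists_ball_subset (mem_interior_iff_mem_nhds.1 hx₀) k
  have h₀ : ∀ i, ‖f i x₀‖ ≤ c := hm x₀ (by simpa using hε)
  refine ⟨m, hkm, 2 * (2 * c) / ε, by positivity, fun i x => ?_⟩
  refine norm_le_of_ball_bound (p m).toLinearMap (f i).toLinearMap hε ?_ x
  intro y hy
  have h1 : ‖f i (y + x₀)‖ ≤ c := hm (y + x₀) (by simpa using hy) i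
  have h2 : f i y = f i (y + x₀) - f i x₀ := by simp
  show ‖f i y‖ ≤ _
  rw [h2]
  linarith [norm_sub_le (f i (y + x₀)) (f i x₀), h₀ i]

end IsQuojection

end QuojectionMaps

/-! ### Strict projective limits of Banach spaces -/

section ProjectiveLimitMaps

variable {𝕜 : Type*} [RCLike 𝕜] {E : ℕ → Type*}
  [∀ n, NormedAddCommGroup (E n)] [∀ n, NormedSpace 𝕜 (E n)]
  {link : ∀ n m : ℕ, n ≤ m → (E m →L[𝕜] E n)}
  {X : Type*} [AddCommGroup X] [Module 𝕜 X] [TopologicalSpace X]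

/-- The canonical map `X → E n`. -/
noncomputable def projLimCoord (e : X ≃L[𝕜] projLim link) (n : ℕ) : X →L[𝕜] E n :=
  (ContinuousLinearMap.proj n).comp ((projLim link).subtypeL.comp (e : X →L[𝕜] projLim link))

theorem projLimCoord_apply (e : X ≃L[𝕜] projLim link) (n : ℕ) (x : X) :
    projLimCoord e n x = (e x : ∀ i, E i) n := rfl

theorem isClosed_projLim : IsClosed (projLim link : Set (∀ n, E n)) := by
  have : (projLim link : Set (∀ n, E n)) =
      ⋂ (n : ℕ) (m : ℕ) (h : n ≤ m), {x | link n m h (x m) = x n} := by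
    ext x; simp [projLim]
  rw [this]
  refine isClosed_iInter fun n => isClosed_iInter fun m => isClosed_iInter fun h => ?_
  exact isClosed_eq (by fun_prop) (by fun_prop)

theorem baireSpace_of_projLim [∀ n, CompleteSpace (E n)] (e : X ≃L[𝕜] projLim link) :
    BaireSpace X := by
  have : TopologicalSpace.IsCompletelyMetrizableSpace (projLim link) :=
    (isClosed_projLim (link := link)).isCompletelyMetrizableSpace
  exact e.symm.toHomeomorph.baireSpace

variable [∀ n, CompleteSpace (E n)]

/-- The open mapping theorem gives norm-controlled preimages under each one-step link; iterating
them upwards from level `n` multiplies finitely many constants at each level, independently of `v`.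
-/
theorem IsStrictProjSystem.exists_lift (hlink : IsStrictProjSystem link) (n : ℕ) :
    ∃ K : ℕ → ℝ, ∀ v : E n, ∃ x : projLim link,
      (x : ∀ i, E i) n = v ∧ ∀ l, ‖(x : ∀ i, E i) l‖ ≤ K l * ‖v‖ := by
  have hsec : ∀ j, ∃ C > 0, ∀ y : E j, ∃ x, link j (j + 1) (Nat.le_succ j) x = y ∧
      ‖x‖ ≤ C * ‖y‖ := fun j =>
    ContinuousLinearMap.exists_preimage_norm_le _ (hlink.surj j (j + 1) (Nat.le_succ j))
  choose C hC σ hσ hσn using hsec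
  have comp : ∀ (a b c : ℕ) (hab : a ≤ b) (hbc : b ≤ c) (y : E c),
      link a b hab (link b c hbc y) = link a c (hab.trans hbc) y := fun a b c hab hbc y => by
    rw [← hlink.map_comp a b c hab hbc]; rfl
  -- Coordinate `l` is linked down from level `n + l`, which lies above both `n` and `l`; no case
  -- distinction is needed.
  refine ⟨fun l => ‖link l (n + l) (Nat.le_add_left l n)‖ * ∏ j ∈ Finset.range l, C (n + j),
    fun v => ?_⟩
  let w : ∀ j, E (n + j) := fun j => Nat.rec (motive := fun j => E (n + j)) v
    (fun j y => σ (n + j) y) j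
  have hw1 : ∀ j, link (n + j) (n + (j + 1)) (by omega) (w (j + 1)) = w j := fun j =>
    hσ (n + j) (w j)
  have hw2 : ∀ i d, link (n + i) (n + (i + d)) (by omega) (w (i + d)) = w i := by
    intro i d
    induction d with
    | zero => exact congrArg (fun f => f (w i)) (hlink.map_id (n + i))
    | succ d ih =>
      rw [← ih, ← hw1 (i + d), comp]
      rfl
  have hw3 : ∀ i j (h : i ≤ j), link (n + i) (n + j) (by omega) (w j) = w i := by
    intro i j h
    obtain ⟨d, rfl⟩ := Nat.exists_eq_add_of_le h
    exact hw2 i d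
  have hwn : ∀ j, ‖w j‖ ≤ (∏ i ∈ Finset.range j, C (n + i)) * ‖v‖ := by
    intro j
    induction j with
    | zero => simp [w]
    | succ j ih =>
      rw [Finset.prod_range_succ]
      calc ‖w (j + 1)‖ ≤ C (n + j) * ‖w j‖ := hσn (n + j) (w j)
        _ ≤ C (n + j) * ((∏ i ∈ Finset.range j, C (n + i)) * ‖v‖) := by
          gcongr; exact (hC _).le
        _ = _ := by ring
  refine ⟨⟨fun l => link l (n + l) (Nat.le_add_left l n) (w l), ?_⟩, ?_, ?_⟩
  · intro i j h
    show link i j h (link j (n + j) _ (w j)) = link i (n + i) _ (w i)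
    rw [comp, ← hw3 i j h, comp]
  · exact hw3 0 n (Nat.zero_le n)
  · intro l
    rw [mul_assoc]
    exact (ContinuousLinearMap.le_opNorm _ _).trans (by gcongr; exact hwn l)

/-- In `glue`, compatibility with every factorization `L` is available, in particular with the
linking maps. -/
theorem IsStrictProjSystem.isQuojection (hlink : IsStrictProjSystem link)
    (e : X ≃L[𝕜] projLim link) : IsQuojection (projLimCoord e) where
  isInducing := IsInducing.subtypeVal.comp e.toHomeomorph.isInducing
  ext x y h := e.injective (Subtype.ext (funext h))
  factor n m h := ⟨link n m h, fun x => ((e x).2 n m h).symm⟩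
  lift n := by
    obtain ⟨K, hK⟩ := hlink.exists_lift n
    refine ⟨K, fun v => ?_⟩
    obtain ⟨x, hx⟩ := hK v
    exact ⟨e.symm x, by simpa [projLimCoord_apply] using hx⟩
  glue v hv := ⟨e.symm ⟨v, fun n m h => hv n m (link n m h) fun x => ((e x).2 n m h).symm⟩,
    fun n => by simp [projLimCoord_apply]⟩

end ProjectiveLimitMaps

/-! ### Semigroups with an everywhere defined generator -/

section GeneratedSemigroups

variable {𝕜 : Type*} [RCLike 𝕜] {E : ℕ → Type*}
  [∀ n, NormedAddCommGroup (E n)] [∀ n, NormedSpace 𝕜 (E n)]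
  {X : Type*} [AddCommGroup X] [Module 𝕜 X] [TopologicalSpace X]
  {p : ∀ n, X →L[𝕜] E n}

namespace StronglyContSemigroup

theorem isGeneratedBy_iff [IsTopologicalAddGroup X] [ContinuousSMul 𝕜 X] [T2Space X]
    {T : StronglyContSemigroup 𝕜 X} {A : X →L[𝕜] X} :
    T.IsGeneratedBy A ↔ ∀ x, T.HasOrbitDeriv x (A x) := by
  constructor
  · intro h x
    obtain ⟨h1, h2⟩ := LinearPMap.ext_iff.1 h
    have hx : x ∈ T.generator.domain := by rw [h1]; trivial
    have hx' : T.generator ⟨x, hx⟩ = A x := h2 (hg := Submodule.mem_top)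
    rw [← hx']
    exact Classical.choose_spec hx
  · intro h
    refine LinearPMap.ext ?_ ?_
    · exact eq_top_iff.2 fun x _ => ⟨A x, h x⟩
    · intro x hf hg
      exact tendsto_nhds_unique (Classical.choose_spec hf) (h x)

/-- Orbits over `[0, R]` are compact, so Banach–Steinhaus gives local equicontinuity. -/
theorem exists_orbit_bound [BaireSpace X] (hp : IsQuojection p) (T : StronglyContSemigroup 𝕜 X)
    (n k : ℕ) (R : ℝ≥0) :
    ∃ m, k ≤ m ∧ ∃ C, 0 ≤ C ∧ ∀ t ≤ R, ∀ x, ‖p n (T.op t x)‖ ≤ C * ‖p m x‖ := by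
  obtain ⟨m, hkm, C, hC, h⟩ := hp.banach_steinhaus
    (fun t : Set.Iic R => (p n).comp (T.op t)) (fun x => by
      have hc : IsCompact (Set.Iic R) := by
        rw [← Set.Icc_bot]; exact isCompact_Icc
      have hcont : Continuous fun t => ‖p n (T.op t x)‖ :=
        ((p n).continuous.comp (T.continuous_orbit x)).norm
      obtain ⟨c, hc⟩ := (hc.image hcont).bddAbove
      exact ⟨c, fun t => hc ⟨t, t.2, rfl⟩⟩) k
  exact ⟨m, hkm, C, hC, fun t ht x => h ⟨t, ht⟩ x⟩

/-- The orbits of a semigroup generated by `A` have iterated derivatives `A ^ k`; these vanish in a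
coordinate as soon as the orbit does. -/
theorem coord_pow_eq_zero {T : StronglyContSemigroup 𝕜 X} {A : X →L[𝕜] X}
    (hA : ∀ x, T.HasOrbitDeriv x (A x)) {n : ℕ} {x : X}
    (h : ∀ t < 1, p n (T.op t x) = 0) (k : ℕ) : p n ((A ^ k) x) = 0 := by
  -- The induction needs all times `t < 1`: `p n (T_s (A y))` is a limit of difference quotients of
  -- the orbit of `y` at times `s` and `s + r`, and the open condition `s < 1` leaves room for `r`.
  suffices ∀ t < 1, p n (T.op t ((A ^ k) x)) = 0 by
    simpa [T.op_zero] using this 0 one_pos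
  induction k with
  | zero => simpa using h
  | succ k ih =>
    intro s hs
    have h1 : Tendsto (fun r : ℝ≥0 => p n (T.op s ((((r : ℝ) : 𝕜))⁻¹ •
        (T.op r ((A ^ k) x) - (A ^ k) x)))) (𝓝[>] 0) (𝓝 (p n (T.op s (A ((A ^ k) x))))) :=
      (((p n).comp (T.op s)).continuous.tendsto _).comp (hA ((A ^ k) x))
    have h2 : (fun r : ℝ≥0 => p n (T.op s ((((r : ℝ) : 𝕜))⁻¹ •
        (T.op r ((A ^ k) x) - (A ^ k) x)))) =ᶠ[𝓝[>] 0] fun _ => 0 := by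
      have : ∀ᶠ r : ℝ≥0 in 𝓝[>] 0, s + r < 1 := by
        have hc : Tendsto (fun r : ℝ≥0 => s + r) (𝓝[>] 0) (𝓝 (s + 0)) :=
          ((continuous_const.add continuous_id).tendsto _).mono_left nhdsWithin_le_nhds
        exact hc.eventually_lt_const (by simpa using hs)
      filter_upwards [this] with r hr
      have h3 : T.op s (T.op r ((A ^ k) x)) = T.op (s + r) ((A ^ k) x) := by
        rw [T.op_add]; rfl
      rw [map_smul, map_smul, map_sub, map_sub, h3, ih _ hr, ih _ hs, sub_zero, smul_zero]
    rw [pow_succ']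
    exact tendsto_nhds_unique (h1.congr' h2) tendsto_const_nhds |>.symm ▸ rfl

section RealDerivatives

variable [∀ n, NormedSpace ℝ (E n)] [∀ n, IsScalarTower ℝ 𝕜 (E n)]

theorem HasOrbitDeriv.hasDerivWithinAt {T : StronglyContSemigroup 𝕜 X} {x y : X}
    (h : T.HasOrbitDeriv x y) (n : ℕ) {s : ℝ} (hs : 0 ≤ s) :
    HasDerivWithinAt (fun r : ℝ => p n (T.op r.toNNReal x)) (p n (T.op s.toNNReal y))
      (Set.Ici s) s := by
  rw [hasDerivWithinAt_iff_tendsto_slope, Set.Ici_sdiff_left]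
  have h1 : Tendsto (fun r : ℝ => (r - s).toNNReal) (𝓝[>] s) (𝓝[>] 0) := by
    refine tendsto_nhdsWithin_iff.2 ⟨?_, ?_⟩
    · have : Continuous fun r : ℝ => (r - s).toNNReal := by fun_prop
      have := this.tendsto s
      rw [sub_self, Real.toNNReal_zero] at this
      exact this.mono_left nhdsWithin_le_nhds
    · exact eventually_nhdsWithin_of_forall fun r hr => by
        simpa using hr
  have h2 := (((p n).comp (T.op s.toNNReal)).continuous.tendsto y).comp (h.comp h1)
  refine h2.congr' (eventually_nhdsWithin_of_forall fun r hr => ?_)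
  have hr' : s < r := hr
  have h3 : r.toNNReal = s.toNNReal + (r - s).toNNReal := by
    rw [← Real.toNNReal_add hs (by linarith)]; congr 1; ring
  have h4 : T.op s.toNNReal (T.op (r - s).toNNReal x) = T.op r.toNNReal x := by
    rw [h3, T.op_add]; rfl
  simp only [Function.comp, ContinuousLinearMap.comp_apply, slope, vsub_eq_sub]
  rw [Real.coe_toNNReal _ (by linarith), map_smul, map_smul, map_sub, map_sub, h4,
    RCLike.real_smul_eq_coe_smul (K := 𝕜), RCLike.ofReal_inv]

/-- By induction on `N`: the right derivative of the remainder of order `N + 1` at `x` is the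
remainder of order `N` at `A x`, and the mean value inequality needs right derivatives only. -/
theorem norm_taylor_le {T : StronglyContSemigroup 𝕜 X} {A : X →L[𝕜] X}
    (hA : ∀ x, T.HasOrbitDeriv x (A x)) (n N : ℕ) {R D : ℝ} (x : X)
    (hD : ∀ s, 0 ≤ s → s ≤ R → ‖p n (T.op s.toNNReal ((A ^ N) x))‖ ≤ D) {t : ℝ} (ht : 0 ≤ t)
    (htR : t ≤ R) :
    ‖p n (T.op t.toNNReal x) - ∑ k ∈ Finset.range N, (t ^ k / (k ! : ℝ)) • p n ((A ^ k) x)‖ ≤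
      D * (t ^ N / (N ! : ℝ)) := by
  induction N generalizing x t with
  | zero => simpa using hD t ht htR
  | succ N ih =>
    have hpow : ∀ k, (A ^ (k + 1)) x = (A ^ k) (A x) := fun k => by rw [pow_succ]; rfl
    have hmono : ∀ j : ℕ, ∀ s : ℝ, HasDerivAt (fun r : ℝ => r ^ (j + 1) / ((j + 1)! : ℝ))
        (s ^ j / (j ! : ℝ)) s := by
      intro j s
      have := (hasDerivAt_pow (j + 1) s).div_const ((j + 1)! : ℝ)
      convert! this using 1
      rw [Nat.factorial_succ, Nat.add_sub_cancel]
      have h1 : (j ! : ℝ) ≠ 0 := by positivity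
      push_cast
      field_simp
    have hsum : ∀ s : ℝ, HasDerivAt
        (fun r : ℝ => ∑ k ∈ Finset.range (N + 1), (r ^ k / (k ! : ℝ)) • p n ((A ^ k) x))
        (∑ k ∈ Finset.range N, (s ^ k / (k ! : ℝ)) • p n ((A ^ k) (A x))) s := by
      intro s
      simp_rw [Finset.sum_range_succ', hpow]
      simp only [pow_zero]
      exact (HasDerivAt.fun_sum fun j _ => (hmono j s).smul_const _).add_const _
    have hcont : Continuous fun r : ℝ => p n (T.op r.toNNReal x) :=
      (p n).continuous.comp ((T.continuous_orbit x).comp continuous_real_toNNReal)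
    refine image_norm_le_of_norm_deriv_right_le_deriv_boundary (a := 0) (b := R)
      (f := fun r : ℝ => p n (T.op r.toNNReal x) -
        ∑ k ∈ Finset.range (N + 1), (r ^ k / (k ! : ℝ)) • p n ((A ^ k) x))
      (f' := fun r : ℝ => p n (T.op r.toNNReal (A x)) -
        ∑ k ∈ Finset.range N, (r ^ k / (k ! : ℝ)) • p n ((A ^ k) (A x)))
      (B := fun r => D * (r ^ (N + 1) / ((N + 1)! : ℝ))) (B' := fun r => D * (r ^ N / (N ! : ℝ)))
      ?_ ?_ ?_ ?_ ?_ ⟨ht, htR⟩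
    · exact (hcont.sub (continuous_iff_continuousAt.2 fun s => (hsum s).continuousAt)).continuousOn
    · intro s hs
      exact ((hA x).hasDerivWithinAt n hs.1).sub (hsum s).hasDerivWithinAt
    · simp [Finset.sum_range_succ', T.op_zero]
    · intro s
      exact (hmono N s).const_mul D
    · intro s hs
      exact ih (A x) (fun r h0 hr => by rw [← hpow]; exact hD r h0 hr) hs.1 hs.2.le

end RealDerivatives

end StronglyContSemigroup

/-- If the powers of `A` respect the kernels of the coordinates, they grow at most exponentially. -/
theorem IsQuojection.exists_pow_bound (hp : IsQuojection p) {A : X →L[𝕜] X}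
    (h : ∀ n, ∃ m, ∀ k x, p m x = 0 → p n ((A ^ k) x) = 0) (n : ℕ) :
    ∃ m C M, 0 ≤ C ∧ 0 ≤ M ∧ ∀ k x, ‖p n ((A ^ k) x)‖ ≤ C * M ^ k * ‖p m x‖ := by
  obtain ⟨m, hnm, hm⟩ : ∃ m, n ≤ m ∧ ∀ k x, p m x = 0 → p n ((A ^ k) x) = 0 := by
    obtain ⟨m, hm⟩ := h n
    refine ⟨max n m, le_max_left _ _, fun k x hx => hm k x ?_⟩
    obtain ⟨L, hL⟩ := hp.factor m (max n m) (le_max_right _ _)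
    rw [hL, hx, map_zero]
  obtain ⟨l, -, C₁, hC₁, hl⟩ := hp.exists_bound ((p m).comp A) 0
  obtain ⟨K, hK⟩ := hp.lift m
  obtain ⟨C₂, hC₂, hn⟩ := hp.norm_le hnm
  have hKm : 0 ≤ |K l| := abs_nonneg _
  refine ⟨m, C₂, C₁ * |K l|, hC₂, by positivity, fun k x => ?_⟩
  -- `A ^ k x` need not be controlled in coordinate `m`. Its substitute `w` is, and has the same
  -- coordinate `n` under all further powers of `A`. The next substitute is `A z`, with `z` a
  -- controlled lift of `p m w`: the kernel condition applies to `z - w`.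
  have key : ∀ k, ∃ w, ‖p m w‖ ≤ (C₁ * |K l|) ^ k * ‖p m x‖ ∧
      ∀ j, p n ((A ^ j) w) = p n ((A ^ j) ((A ^ k) x)) := by
    intro k
    induction k with
    | zero => exact ⟨x, by simp, fun j => by simp⟩
    | succ k ih =>
      obtain ⟨w, hw, hwj⟩ := ih
      obtain ⟨z, hz, hzl⟩ := hK (p m w)
      refine ⟨A z, ?_, fun j => ?_⟩
      · calc ‖p m (A z)‖ ≤ C₁ * ‖p l z‖ := hl z
          _ ≤ C₁ * (|K l| * ‖p m w‖) := by
            gcongr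
            exact (hzl l).trans (by gcongr; exact le_abs_self _)
          _ ≤ C₁ * (|K l| * ((C₁ * |K l|) ^ k * ‖p m x‖)) := by gcongr
          _ = _ := by ring
      · have h1 := hm (j + 1) (z - w) (by rw [map_sub, hz, sub_self])
        rw [map_sub, map_sub, sub_eq_zero, hwj (j + 1)] at h1
        have e1 : (A ^ j) (A z) = (A ^ (j + 1)) z := by rw [pow_succ]; rfl
        have e2 : (A ^ j) ((A ^ (k + 1)) x) = (A ^ (j + 1)) ((A ^ k) x) := by
          rw [pow_succ' A k, pow_succ A j]; rfl
        rw [e1, e2, h1]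
  obtain ⟨w, hw, hwj⟩ := key k
  have h0 : p n ((A ^ k) x) = p n w := by simpa using (hwj 0).symm
  rw [h0, mul_assoc]
  exact (hn w).trans (by gcongr)

namespace StronglyContSemigroup

theorem exists_ker_le [BaireSpace X] (hp : IsQuojection p) {T : StronglyContSemigroup 𝕜 X}
    {A : X →L[𝕜] X} (hA : ∀ x, T.HasOrbitDeriv x (A x)) (n : ℕ) :
    ∃ m, ∀ k x, p m x = 0 → p n ((A ^ k) x) = 0 := by
  obtain ⟨m, -, C, -, h⟩ := T.exists_orbit_bound hp n 0 1
  refine ⟨m, fun k x hx => coord_pow_eq_zero hA (fun t ht => ?_) k⟩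
  have := h t ht.le x
  rwa [hx, norm_zero, mul_zero, norm_le_zero_iff] at this

/-- Taylor's formula of order one bounds `p n (T_t x - x)` by a multiple of `t`, uniformly for `x`
in a bounded set. -/
theorem isUniformlyCont_of_generator [BaireSpace X] (hp : IsQuojection p)
    {T : StronglyContSemigroup 𝕜 X} {A : X →L[𝕜] X} (hA : ∀ x, T.HasOrbitDeriv x (A x)) :
    T.IsUniformlyCont := by
  let _ : ∀ n, NormedSpace ℝ (E n) := fun n => NormedSpace.restrictScalars ℝ 𝕜 (E n)
  have _ : ∀ n, IsScalarTower ℝ 𝕜 (E n) := fun n => RestrictScalars.isScalarTower ℝ 𝕜 (E n)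
  intro B hB U hU
  obtain ⟨n, -, ε, hε, hn⟩ := hp.exists_ball_subset hU 0
  obtain ⟨m, -, C, hC, h⟩ := T.exists_orbit_bound hp n 0 1
  obtain ⟨l, -, D, hD, hl⟩ := hp.exists_bound ((p m).comp A) 0
  obtain ⟨R, hR, hBR⟩ := hp.bounded_of_isVonNBounded hB l
  have h0 : Tendsto (fun t : ℝ≥0 => C * (D * R) * (t : ℝ)) (𝓝 0) (𝓝 0) := by
    have : Continuous fun t : ℝ≥0 => C * (D * R) * (t : ℝ) := by fun_prop
    simpa using this.tendsto 0
  filter_upwards [h0.eventually_lt_const hε, eventually_le_nhds (zero_lt_one (α := ℝ≥0))]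
    with t ht ht1 x hx
  apply hn
  have := norm_taylor_le (p := p) hA n 1 (R := 1) (D := C * (D * R)) x (fun s _ hs => by
    refine (h _ (by simpa using hs) _).trans ?_
    rw [pow_one]
    gcongr
    exact (hl x).trans (by gcongr; exact hBR x hx)) t.2 (by exact_mod_cast ht1)
  simp only [Finset.range_one, Finset.sum_singleton, pow_zero, Nat.factorial_zero, Nat.cast_one,
    div_one, one_smul, pow_one, Nat.factorial_one] at this
  rw [sub_zero, map_sub]
  refine lt_of_le_of_lt ?_ ht
  simpa using this

/-- Exponential growth of the powers in coordinate `n` gives summability; growth in the coordinate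
`l` that bounds the orbit sends the Taylor remainder to zero. -/
theorem hasSum_of_generator [∀ n, CompleteSpace (E n)] [BaireSpace X] (hp : IsQuojection p)
    {T : StronglyContSemigroup 𝕜 X} {A : X →L[𝕜] X} (hA : ∀ x, T.HasOrbitDeriv x (A x))
    (x : X) (t : ℝ≥0) :
    HasSum (fun k : ℕ => (((t : ℝ) ^ k / (k ! : ℝ) : ℝ) : 𝕜) • (A ^ k) x) (T.op t x) := by
  let _ : ∀ n, NormedSpace ℝ (E n) := fun n => NormedSpace.restrictScalars ℝ 𝕜 (E n)
  have _ : ∀ n, IsScalarTower ℝ 𝕜 (E n) := fun n => RestrictScalars.isScalarTower ℝ 𝕜 (E n)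
  rw [hp.hasSum_iff]
  intro n
  obtain ⟨l, -, C', hC', hl⟩ := T.exists_orbit_bound hp n 0 t
  have hbd := hp.exists_pow_bound (exists_ker_le hp hA)
  have hsum : Summable fun k : ℕ => p n ((((t : ℝ) ^ k / (k ! : ℝ) : ℝ) : 𝕜) • (A ^ k) x) := by
    obtain ⟨m, C, M, hC, hM, h⟩ := hbd n
    refine Summable.of_norm_bounded
      ((Real.summable_pow_div_factorial (t * M)).mul_left (C * ‖p m x‖)) fun k => ?_
    rw [map_smul, norm_smul, RCLike.norm_ofReal, abs_of_nonneg (by positivity)]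
    calc (t : ℝ) ^ k / (k ! : ℝ) * ‖p n ((A ^ k) x)‖
        ≤ (t : ℝ) ^ k / (k ! : ℝ) * (C * M ^ k * ‖p m x‖) := by gcongr; exact h k x
      _ = _ := by rw [mul_pow]; ring
  rw [hsum.hasSum_iff_tendsto_nat, ← tendsto_sub_nhds_zero_iff]
  obtain ⟨m, C, M, hC, hM, h⟩ := hbd l
  have hlim : Tendsto (fun N : ℕ => C' * (C * ‖p m x‖) * ((t * M) ^ N / (N ! : ℝ))) atTop (𝓝 0) := by
    simpa using (FloorSemiring.tendsto_pow_div_factorial_atTop ((t : ℝ) * M)).const_mul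
      (C' * (C * ‖p m x‖))
  refine squeeze_zero_norm (fun N => ?_) hlim
  have := norm_taylor_le (p := p) hA n N (R := t) (D := C' * (C * M ^ N * ‖p m x‖)) x
    (fun s _ hs => by
      refine (hl _ (Real.toNNReal_le_iff_le_coe.2 hs) _).trans ?_
      gcongr
      exact h N x) t.2 le_rfl
  rw [norm_sub_rev]
  simp only [NNReal.val_eq_coe, Real.toNNReal_coe, RCLike.real_smul_eq_coe_smul (K := 𝕜)] at this
  simp only [map_smul]
  refine this.trans (le_of_eq ?_)
  rw [mul_pow]; ring

end StronglyContSemigroup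

end GeneratedSemigroups

/-! ### The exponential series as a semigroup -/

section ExponentialSeries

variable {𝕜 : Type*} [RCLike 𝕜] {E : ℕ → Type*}
  [∀ n, NormedAddCommGroup (E n)] [∀ n, NormedSpace 𝕜 (E n)]
  {X : Type*} [AddCommGroup X] [Module 𝕜 X] [TopologicalSpace X]
  {p : ∀ n, X →L[𝕜] E n}

theorem norm_exp_term_le {F : Type*} [NormedAddCommGroup F] [NormedSpace 𝕜 F] (f : X →L[𝕜] F)
    {A : X →L[𝕜] X} {x : X} {C M D : ℝ} (h : ∀ k, ‖f ((A ^ k) x)‖ ≤ C * M ^ k * D)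
    (t : ℝ≥0) (k : ℕ) :
    ‖f ((((t : ℝ) ^ k / (k ! : ℝ) : ℝ) : 𝕜) • (A ^ k) x)‖ ≤ C * D * ((t * M) ^ k / (k ! : ℝ)) := by
  rw [map_smul, norm_smul, RCLike.norm_ofReal, abs_of_nonneg (by positivity)]
  calc (t : ℝ) ^ k / (k ! : ℝ) * ‖f ((A ^ k) x)‖
      ≤ (t : ℝ) ^ k / (k ! : ℝ) * (C * M ^ k * D) := by gcongr; exact h k
    _ = _ := by rw [mul_pow]; ring

variable [∀ n, CompleteSpace (E n)]

theorem IsQuojection.exists_hasSum_exp (hp : IsQuojection p) {A : X →L[𝕜] X}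
    (H : ∀ n, ∃ m C M, 0 ≤ C ∧ 0 ≤ M ∧ ∀ k x, ‖p n ((A ^ k) x)‖ ≤ C * M ^ k * ‖p m x‖)
    (t : ℝ≥0) (x : X) :
    ∃ y, HasSum (fun k : ℕ => (((t : ℝ) ^ k / (k ! : ℝ) : ℝ) : 𝕜) • (A ^ k) x) y := by
  have hs : ∀ n, Summable fun k : ℕ =>
      p n ((((t : ℝ) ^ k / (k ! : ℝ) : ℝ) : 𝕜) • (A ^ k) x) := by
    intro n
    obtain ⟨m, C, M, hC, hM, h⟩ := H n
    exact Summable.of_norm_bounded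
      ((Real.summable_pow_div_factorial (t * M)).mul_left (C * ‖p m x‖))
      (norm_exp_term_le (p n) (fun k => h k x) t)
  obtain ⟨y, hy⟩ := hp.glue
    (fun n => ∑' k : ℕ, p n ((((t : ℝ) ^ k / (k ! : ℝ) : ℝ) : 𝕜) • (A ^ k) x))
    (fun n m L hL => by simp only [L.map_tsum (hs m), ← hL])
  exact ⟨y, hp.hasSum_iff.2 fun n => by rw [hy]; exact (hs n).hasSum⟩

/-- The Cauchy product of two exponential series. -/
theorem hasSum_exp_add {F : Type*} [NormedAddCommGroup F] [NormedSpace 𝕜 F] [CompleteSpace F]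
    (f : X →L[𝕜] F) {A : X →L[𝕜] X} {x y z : X} {C M D : ℝ} (hM : 0 ≤ M)
    (h : ∀ k, ‖f ((A ^ k) x)‖ ≤ C * M ^ k * D) {s t : ℝ≥0}
    (hy : HasSum (fun k : ℕ => (((t : ℝ) ^ k / (k ! : ℝ) : ℝ) : 𝕜) • (A ^ k) x) y)
    (hz : HasSum (fun k : ℕ => (((s : ℝ) ^ k / (k ! : ℝ) : ℝ) : 𝕜) • (A ^ k) y) z) :
    HasSum (fun k : ℕ => f (((((s + t : ℝ≥0) : ℝ) ^ k / (k ! : ℝ) : ℝ) : 𝕜) • (A ^ k) x))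
      (f z) := by
  -- Summed by rows, this absolutely summable family gives `f z`; summed along antidiagonals, it
  -- gives the series at `s + t` by the binomial theorem.
  let G : ℕ × ℕ → F := fun q =>
    (((s : ℝ) ^ q.1 / (q.1 ! : ℝ) * ((t : ℝ) ^ q.2 / (q.2 ! : ℝ)) : ℝ) : 𝕜) •
      f ((A ^ (q.1 + q.2)) x)
  have hGs : Summable G := by
    have h1 := (Real.summable_pow_div_factorial (s * M)).mul_of_nonneg
      (Real.summable_pow_div_factorial (t * M)) (fun k => by positivity) (fun k => by positivity)
    refine Summable.of_norm_bounded (h1.mul_left (C * D)) fun q => ?_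
    simp only [G]
    rw [norm_smul, RCLike.norm_ofReal, abs_of_nonneg (by positivity)]
    calc _ ≤ (s : ℝ) ^ q.1 / (q.1 ! : ℝ) * ((t : ℝ) ^ q.2 / (q.2 ! : ℝ)) *
          (C * M ^ (q.1 + q.2) * D) := by gcongr; exact h _
      _ = _ := by rw [mul_pow, mul_pow, pow_add]; ring
  have hrow : ∀ j, HasSum (fun k => G (j, k))
      (f ((((s : ℝ) ^ j / (j ! : ℝ) : ℝ) : 𝕜) • (A ^ j) y)) := by
    intro j
    have := (hy.mapL (f.comp (A ^ j))).const_smul (((s : ℝ) ^ j / (j ! : ℝ) : ℝ) : 𝕜)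
    rw [map_smul]
    refine this.congr_fun fun k => ?_
    simp only [G, map_smul, smul_smul, ContinuousLinearMap.comp_apply, RCLike.ofReal_mul, pow_add]
    rfl
  have hG : HasSum G (f z) := by
    have h1 := hGs.hasSum.prod_fiberwise hrow
    rw [← h1.unique (hz.mapL f)]
    exact hGs.hasSum
  rw [← Finset.HasAntidiagonal.sigmaAntidiagonalEquivProd.hasSum_iff] at hG
  have hsum := hG.sigma fun n => hasSum_fintype _
  convert! hsum using 1
  funext n
  simp only [Function.comp, Finset.HasAntidiagonal.sigmaAntidiagonalEquivProd_apply]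
  refine Eq.trans ?_ (Finset.sum_coe_sort (Finset.HasAntidiagonal.antidiagonal n) G).symm
  have hq : ∀ q ∈ Finset.HasAntidiagonal.antidiagonal n, G q =
      (((s : ℝ) ^ q.1 / (q.1 ! : ℝ) * ((t : ℝ) ^ q.2 / (q.2 ! : ℝ)) : ℝ) : 𝕜) •
        f ((A ^ n) x) := fun q hq => by
    simp only [G]
    rw [Finset.HasAntidiagonal.mem_antidiagonal.1 hq]
  rw [Finset.sum_congr rfl hq, ← Finset.sum_smul, ← RCLike.ofReal_sum, map_smul]
  congr 2
  rw [NNReal.coe_add, (Commute.all (s : ℝ) t).add_pow', Finset.sum_div]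
  refine Finset.sum_congr rfl fun q hq => ?_
  obtain rfl := Finset.HasAntidiagonal.mem_antidiagonal.1 hq
  rw [nsmul_eq_mul, Nat.choose_symm_add, Nat.add_choose, Nat.cast_div (Nat.factorial_mul_factorial_dvd_factorial_add _ _)
    (by positivity)]
  push_cast
  have h1 : (q.1 ! : ℝ) ≠ 0 := by positivity
  have h2 : (q.2 ! : ℝ) ≠ 0 := by positivity
  have h3 : ((q.1 + q.2)! : ℝ) ≠ 0 := by positivity
  field_simp

/-- An operator whose powers grow at most exponentially in each coordinate is a generator. -/
theorem IsQuojection.exists_semigroup [IsTopologicalAddGroup X] [ContinuousSMul 𝕜 X] [T2Space X]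
    (hp : IsQuojection p) {A : X →L[𝕜] X}
    (H : ∀ n, ∃ m C M, 0 ≤ C ∧ 0 ≤ M ∧ ∀ k x, ‖p n ((A ^ k) x)‖ ≤ C * M ^ k * ‖p m x‖) :
    ∃ T : StronglyContSemigroup 𝕜 X, ∀ x, T.HasOrbitDeriv x (A x) := by
  choose S hS using hp.exists_hasSum_exp H
  let S' : ℝ≥0 → X →ₗ[𝕜] X := fun t =>
    { toFun := S t
      map_add' := fun x y => (hS t (x + y)).unique (by
        simpa only [map_add, smul_add] using (hS t x).add (hS t y))
      map_smul' := fun c x => (hS t (c • x)).unique (by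
        simpa only [map_smul, smul_comm c, RingHom.id_apply] using (hS t x).const_smul c) }
  have hcont : ∀ t, Continuous (S' t) := fun t => by
    refine hp.continuous_of_bound _ fun n => ?_
    obtain ⟨m, C, M, hC, hM, h⟩ := H n
    refine ⟨m, C * ∑' k : ℕ, (t * M) ^ k / (k ! : ℝ), fun x => ?_⟩
    refine (((hS t x).mapL (p n)).norm_le_of_bounded
      ((Real.summable_pow_div_factorial (t * M)).hasSum.mul_left (C * ‖p m x‖))
      (norm_exp_term_le (p n) (fun k => h k x) t)).trans (le_of_eq (by ring))
  have hcoord : ∀ n x, Continuous fun t : ℝ≥0 => p n (S t x) := by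
    intro n x
    obtain ⟨m, C, M, hC, hM, h⟩ := H n
    have heq : (fun t : ℝ≥0 => p n (S t x)) = fun t : ℝ≥0 =>
        ∑' k : ℕ, p n ((((t : ℝ) ^ k / (k ! : ℝ) : ℝ) : 𝕜) • (A ^ k) x) :=
      funext fun t => ((hS t x).mapL (p n)).tsum_eq.symm
    rw [heq, continuous_iff_continuousAt]
    intro t
    -- A dominating series independent of the time exists only on bounded time intervals.
    refine ContinuousOn.continuousAt (s := Set.Iio (t + 1)) ?_
      (Iio_mem_nhds (lt_add_of_pos_right t one_pos))
    refine continuousOn_tsum (fun k => ?_)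
      ((Real.summable_pow_div_factorial ((t + 1) * M)).mul_left (C * ‖p m x‖)) fun k s hs => ?_
    · refine Continuous.continuousOn ?_
      have h1 : Continuous fun s : ℝ≥0 => (((s : ℝ) ^ k / (k ! : ℝ) : ℝ) : 𝕜) := by fun_prop
      fun_prop
    · refine (norm_exp_term_le (p n) (fun k => h k x) s k).trans ?_
      have hs' : (s : ℝ) ≤ t + 1 := by exact_mod_cast (show s < t + 1 from hs).le
      gcongr
  let T : StronglyContSemigroup 𝕜 X :=
    { op := fun t => ⟨S' t, hcont t⟩
      op_zero := by
        ext x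
        refine (hS 0 x).unique ?_
        convert! hasSum_single (f := fun k : ℕ =>
          ((((0 : ℝ≥0) : ℝ) ^ k / (k ! : ℝ) : ℝ) : 𝕜) • (A ^ k) x) 0 (fun k hk => by simp [hk]) using 1
        simp
      op_add := fun s t => by
        ext x
        refine hp.ext _ _ fun n => ?_
        obtain ⟨m, C, M, hC, hM, h⟩ := H n
        exact ((hS (s + t) x).mapL (p n)).unique
          (hasSum_exp_add (p n) hM (fun k => h k x) (hS t x) (hS s (S t x)))
      continuous_orbit := fun x => continuous_iff_continuousAt.2 fun t =>
        hp.tendsto_iff.2 fun n => (hcoord n x).tendsto t }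
  refine ⟨T, fun x => hp.tendsto_iff.2 fun n => ?_⟩
  obtain ⟨m, C, M, hC, hM, h⟩ := H n
  rw [← tendsto_sub_nhds_zero_iff]
  -- For `r ≤ 1` the series without its first two terms is at most `r ^ 2 * B`, using `k! ≤ (k +
  -- 2)!`; division by `r` leaves `r * B`.
  let B := C * ‖p m x‖ * M ^ 2 * ∑' k : ℕ, M ^ k / (k ! : ℝ)
  have hB : Tendsto (fun r : ℝ≥0 => (r : ℝ) * B) (𝓝[>] 0) (𝓝 0) := by
    have : Continuous fun r : ℝ≥0 => (r : ℝ) * B := by fun_prop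
    simpa using (this.tendsto 0).mono_left nhdsWithin_le_nhds
  refine squeeze_zero_norm' ?_ hB
  have h1 : ∀ᶠ r : ℝ≥0 in 𝓝[>] 0, r ≤ 1 :=
    nhdsWithin_le_nhds (eventually_le_nhds (zero_lt_one (α := ℝ≥0)))
  filter_upwards [h1, self_mem_nhdsWithin] with r hr1 hr0
  have hr0' : (0 : ℝ) < r := NNReal.coe_pos.2 hr0
  have hr1' : (r : ℝ) ≤ 1 := by exact_mod_cast hr1
  have htail := (hasSum_nat_add_iff' 2).2 ((hS r x).mapL (p n))
  have hbound := htail.norm_le_of_bounded (((Real.summable_pow_div_factorial M).hasSum.mul_left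
    (C * ‖p m x‖ * M ^ 2)).mul_left ((r : ℝ) ^ 2)) fun k => by
      refine (norm_exp_term_le (p n) (fun k => h k x) r (k + 2)).trans ?_
      calc C * ‖p m x‖ * ((r * M) ^ (k + 2) / ((k + 2)! : ℝ))
          ≤ C * ‖p m x‖ * ((r * M) ^ (k + 2) / (k ! : ℝ)) := by
            gcongr; omega
        _ = (r : ℝ) ^ 2 * (C * ‖p m x‖ * M ^ 2 * (((r : ℝ) * M) ^ k / (k ! : ℝ))) := by ring
        _ ≤ (r : ℝ) ^ 2 * (C * ‖p m x‖ * M ^ 2 * ((1 * M) ^ k / (k ! : ℝ))) := by gcongr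
        _ = _ := by rw [one_mul]
  have hrep : p n ((((r : ℝ) : 𝕜))⁻¹ • (T.op r x - x)) - p n (A x) = (((r : ℝ) : 𝕜))⁻¹ •
      (p n (S r x) - ∑ k ∈ Finset.range 2,
        p n ((((r : ℝ) ^ k / (k ! : ℝ) : ℝ) : 𝕜) • (A ^ k) x)) := by
    have hr : ((r : ℝ) : 𝕜) ≠ 0 := by exact_mod_cast hr0'.ne'
    have hT : T.op r x = S r x := rfl
    simp only [Finset.sum_range_succ, Finset.sum_range_zero, zero_add, pow_zero, pow_one,
      Nat.factorial_zero, Nat.factorial_one, Nat.cast_one, div_one, RCLike.ofReal_one, one_smul,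
      map_smul, map_sub, hT, one_apply_eq_self, smul_sub, smul_add,
      inv_smul_smul₀ hr]
    abel
  rw [hrep, norm_smul, norm_inv, RCLike.norm_ofReal, abs_of_pos hr0', inv_mul_le_iff₀ hr0']
  exact hbound.trans (le_of_eq (by simp only [B]; ring))

end ExponentialSeries

/-! ### Uniformly continuous semigroups have everywhere defined generators -/

/-- A map that is close to a surjective linear map is surjective. -/
theorem ApproximatesLinearOn.surjective_of_nonlinearRightInverse {𝕜 : Type*}
    [NontriviallyNormedField 𝕜] {F G : Type*} [NormedAddCommGroup F] [NormedSpace 𝕜 F]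
    [CompleteSpace F] [NormedAddCommGroup G] [NormedSpace 𝕜 G] {f : F → G} {L : F →L[𝕜] G} {c : ℝ≥0}
    (hf : ApproximatesLinearOn f L Set.univ c) (R : L.NonlinearRightInverse)
    (hc : (c : ℝ) < (R.nnnorm : ℝ)⁻¹) : Function.Surjective f := by
  intro y
  have hpos : 0 < (R.nnnorm : ℝ)⁻¹ - c := sub_pos.2 hc
  -- The image of the ball of radius `ε` about `0` contains the ball of radius `((R.nnnorm)⁻¹ - c) *
  -- ε` about `f 0`; `ε` is chosen so that `y` lies in the latter.
  obtain ⟨x, -, hx⟩ := hf.surjOn_closedBall_of_nonlinearRightInverse R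
    (ε := ‖y - f 0‖ / ((R.nnnorm : ℝ)⁻¹ - c)) (b := 0) (by positivity) (Set.subset_univ _)
    (show y ∈ _ by
      rw [mul_div_cancel₀ _ hpos.ne', Metric.mem_closedBall, dist_eq_norm])
  exact ⟨x, hx⟩

namespace StronglyContSemigroup

variable {𝕜 : Type*} [RCLike 𝕜] {E : ℕ → Type*}
  [∀ n, NormedAddCommGroup (E n)] [∀ n, NormedSpace 𝕜 (E n)]
  {X : Type*} [AddCommGroup X] [Module 𝕜 X] [TopologicalSpace X]
  {p : ∀ n, X →L[𝕜] E n}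

/-- Controlled lifts of unit vectors of `E m` form a bounded set, on which `T_s → id` uniformly. For
`s ≤ 1` the left side depends only on `p m x`, so scaling extends the bound to all `x`. The index
`m` comes from equicontinuity and is independent of `c`; this matters because `c` is later chosen in
terms of the map `E m → E n`. -/
theorem IsUniformlyCont.exists_norm_sub_le [BaireSpace X] (hp : IsQuojection p)
    {T : StronglyContSemigroup 𝕜 X} (hT : T.IsUniformlyCont) (n : ℕ) :
    ∃ m, n ≤ m ∧ ∀ c : ℝ, 0 < c → ∃ δ : ℝ≥0, 0 < δ ∧ ∀ s ≤ δ, ∀ x,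
      ‖p n (T.op s x - x)‖ ≤ c * ‖p m x‖ := by
  obtain ⟨m, hnm, C, hC, h⟩ := T.exists_orbit_bound hp n n 1
  obtain ⟨C', hC', h'⟩ := hp.norm_le hnm
  obtain ⟨K, hK⟩ := hp.lift m
  refine ⟨m, hnm, fun c hc => ?_⟩
  have hB : Bornology.IsVonNBounded 𝕜 {x | ∀ l, ‖p l x‖ ≤ K l} :=
    hp.isVonNBounded_of_bounded K fun x hx => hx
  have hU : {x | ‖p n x‖ < c} ∈ 𝓝 (0 : X) := by
    have h1 : Tendsto (fun x => ‖p n x‖) (𝓝 0) (𝓝 0) := by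
      simpa using (p n).continuous.norm.tendsto 0
    exact h1.eventually_lt_const hc
  obtain ⟨δ, hδ, hδT⟩ := NNReal.nhds_zero_basis.eventually_iff.1
    ((hT _ hB _ hU).and (eventually_le_nhds (zero_lt_one (α := ℝ≥0))))
  have hzero : ∀ s ≤ (1 : ℝ≥0), ∀ x, p m x = 0 → p n (T.op s x - x) = 0 := by
    intro s hs x hx
    have h1 := h s hs x
    have h2 := h' x
    rw [hx, norm_zero, mul_zero, norm_le_zero_iff] at h1 h2
    rw [map_sub, h1, h2, sub_zero]
  refine ⟨δ / 2, half_pos hδ, fun s hs x => ?_⟩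
  obtain ⟨h1, hs1⟩ := hδT (show s ∈ Set.Iio δ from hs.trans_lt (NNReal.half_lt_self hδ.ne'))
  by_cases hx : p m x = 0
  · rw [hzero s hs1 x hx, hx]; simp
  have hx0 : (‖p m x‖ : 𝕜) ≠ 0 := by simpa using hx
  obtain ⟨z, hz, hzl⟩ := hK (((‖p m x‖ : ℝ) : 𝕜)⁻¹ • p m x)
  have hnorm : ‖((‖p m x‖ : ℝ) : 𝕜)⁻¹ • p m x‖ = 1 := by
    rw [norm_smul, norm_inv, RCLike.norm_ofReal, abs_norm, inv_mul_cancel₀ (by simpa using hx)]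
  have hzB : z ∈ {x | ∀ l, ‖p l x‖ ≤ K l} := fun l => by simpa [hnorm] using hzl l
  have h2 := hzero s hs1 (x - (‖p m x‖ : 𝕜) • z) (by
    rw [map_sub, map_smul, hz, smul_inv_smul₀ hx0, sub_self])
  have h3 : T.op s (x - (‖p m x‖ : 𝕜) • z) - (x - (‖p m x‖ : 𝕜) • z) =
      (T.op s x - x) - (‖p m x‖ : 𝕜) • (T.op s z - z) := by
    rw [map_sub, map_smul, smul_sub]; abel
  rw [h3, map_sub, sub_eq_zero, map_smul] at h2
  rw [h2, norm_smul, RCLike.norm_ofReal, abs_norm, mul_comm]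
  gcongr
  exact (h1 z hzB).le

theorem continuous_coord_orbit (T : StronglyContSemigroup 𝕜 X) (n : ℕ) (z : X) :
    Continuous fun s : ℝ => p n (T.op s.toNNReal z) :=
  (p n).continuous.comp ((T.continuous_orbit z).comp continuous_real_toNNReal)

section Integral

variable [∀ n, CompleteSpace (E n)] [∀ n, NormedSpace ℝ (E n)]

/-- The integral is formed in each Banach space `E n`; bounded operators commute with it, so the
coordinates glue. -/
theorem exists_integral (hp : IsQuojection p) (T : StronglyContSemigroup 𝕜 X) (δ : ℝ) (z : X) :
    ∃ y, ∀ n, p n y = ∫ s in (0 : ℝ)..δ, p n (T.op s.toNNReal z) := by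
  refine hp.glue _ fun n m L hL => ?_
  rw [← L.intervalIntegral_comp_comm ((continuous_coord_orbit T m z).intervalIntegrable _ _)]
  simp only [hL]

variable [∀ n, IsScalarTower ℝ 𝕜 (E n)]

/-- The integral of an orbit belongs to the domain of the generator. -/
theorem hasOrbitDeriv_integral (hp : IsQuojection p) (T : StronglyContSemigroup 𝕜 X) {δ : ℝ≥0}
    {z y : X} (hy : ∀ n, p n y = ∫ s in (0 : ℝ)..δ, p n (T.op s.toNNReal z)) :
    T.HasOrbitDeriv y (T.op δ z - z) := by
  rw [HasOrbitDeriv, hp.tendsto_iff]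
  intro l
  let g : ℝ → E l := fun s => p l (T.op s.toNNReal z)
  have hg : Continuous g := continuous_coord_orbit T l z
  have hgi : ∀ a b, IntervalIntegrable g MeasureTheory.volume a b := fun a b =>
    hg.intervalIntegrable a b
  -- The integral exists only coordinatewise, so `T_h` is moved inside it by factoring `p l ∘ T_h`
  -- through a bounded operator on some `E m`.
  have hTh : ∀ h : ℝ≥0, p l (T.op h y) = ∫ s in (h : ℝ)..δ + h, g s := by
    intro h
    obtain ⟨m, -, C, -, hC⟩ := hp.exists_bound ((p l).comp (T.op h)) 0
    obtain ⟨L, hL⟩ := hp.exists_factor ((p l).comp (T.op h)) hC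
    have h1 : p l (T.op h y) = L (p m y) := (hL y).symm
    rw [h1, hy m, ← L.intervalIntegral_comp_comm
      ((continuous_coord_orbit T m z).intervalIntegrable _ _)]
    have h2 := intervalIntegral.integral_comp_add_right (a := 0) (b := δ) g (h : ℝ)
    rw [zero_add] at h2
    rw [← h2]
    refine intervalIntegral.integral_congr fun s hs => ?_
    rw [Set.uIcc_of_le δ.coe_nonneg] at hs
    simp only [hL, g]
    rw [Real.toNNReal_add hs.1 h.coe_nonneg, Real.toNNReal_coe, add_comm, T.op_add]
    rfl
  let G : ℝ → E l := fun u => ∫ s in (0 : ℝ)..u, g s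
  have hG : ∀ u, HasDerivAt G (g u) u := fun u =>
    intervalIntegral.integral_hasDerivAt_right (hgi _ _)
      hg.stronglyMeasurable.stronglyMeasurableAtFilter hg.continuousAt
  -- The increment of this function from `0` to `h` is `p l (T_h y - y)`.
  have hΦ : HasDerivAt (fun u : ℝ => G (δ + u) - G u) (g δ - g 0) 0 := by
    have h1 : HasDerivAt (fun u : ℝ => G (δ + u)) (g δ) 0 := by
      apply HasDerivAt.comp_const_add
      rw [add_zero]
      exact hG δ
    exact h1.sub (hG 0)
  have hcoe : Tendsto (fun h : ℝ≥0 => (h : ℝ)) (𝓝[>] 0) (𝓝[>] 0) := by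
    refine tendsto_nhdsWithin_iff.2 ⟨?_, eventually_nhdsWithin_of_forall fun h hh => ?_⟩
    · exact (NNReal.continuous_coe.tendsto 0).mono_left nhdsWithin_le_nhds
    · exact NNReal.coe_pos.2 hh
  have hlim := hΦ.tendsto_slope_zero_right.comp hcoe
  have h0 : g δ - g 0 = p l (T.op δ z - z) := by
    simp [g, T.op_zero]
  rw [h0] at hlim
  refine hlim.congr fun h => ?_
  have h1 : p l (T.op h y) - p l y = (G (δ + h) - G h) - G δ := by
    rw [hTh, hy, ← intervalIntegral.integral_interval_sub_left (hgi 0 (δ + h)) (hgi 0 h)]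
  have h2 : G 0 = 0 := intervalIntegral.integral_same
  simp only [Function.comp, zero_add, add_zero, h2, sub_zero]
  rw [map_smul, map_sub, h1, RCLike.real_smul_eq_coe_smul (K := 𝕜), RCLike.ofReal_inv]

/-- Means of orbits over a short interval `[0, δ]` lie in the domain. In coordinate `n` they perturb
the surjection `L : E m → E n` so little that every value is still attained. -/
theorem IsUniformlyCont.exists_hasOrbitDeriv_coord_eq [BaireSpace X] (hp : IsQuojection p)
    {T : StronglyContSemigroup 𝕜 X} (hT : T.IsUniformlyCont) (n : ℕ) (x : X) :
    ∃ y y', T.HasOrbitDeriv y y' ∧ p n y = p n x := by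
  obtain ⟨m, hnm, h⟩ := hT.exists_norm_sub_le hp n
  obtain ⟨L, hL⟩ := hp.factor n m hnm
  have hLs : (L : E m →ₗ[𝕜] E n).range = ⊤ := LinearMap.range_eq_top.2 fun v => by
    obtain ⟨x, rfl⟩ := hp.surjective n v
    exact ⟨p m x, (hL x).symm⟩
  let R := L.nonlinearRightInverseOfSurjective hLs
  have hR : 0 < R.nnnorm := L.nonlinearRightInverseOfSurjective_nnnorm_pos hLs
  obtain ⟨δ, hδ, hδT⟩ := h (R.nnnorm⁻¹ / 2 : ℝ≥0) (by positivity)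
  have hδ0 : (0 : ℝ) < δ := hδ
  choose I hI using T.exists_integral hp δ
  have hest : ∀ z, ‖p n (I z) - (δ : ℝ) • p n z‖ ≤ (R.nnnorm⁻¹ / 2 : ℝ≥0) * ‖p m z‖ * δ := by
    intro z
    have h1 : p n (I z) - (δ : ℝ) • p n z =
        ∫ s in (0 : ℝ)..δ, (p n (T.op s.toNNReal z) - p n z) := by
      rw [intervalIntegral.integral_sub
        ((continuous_coord_orbit T n z).intervalIntegrable _ _) (by simp), ← hI,
        intervalIntegral.integral_const, sub_zero]
    rw [h1]
    refine (intervalIntegral.norm_integral_le_of_norm_le_const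
      (C := (R.nnnorm⁻¹ / 2 : ℝ≥0) * ‖p m z‖) fun s hs => ?_).trans ?_
    · rw [Set.uIoc_of_le hδ0.le] at hs
      rw [← map_sub]
      exact hδT _ (Real.toNNReal_le_iff_le_coe.2 hs.2) z
    · rw [sub_zero, abs_of_pos hδ0]
  have hIsub : ∀ a b, p n (I (a - b)) = p n (I a) - p n (I b) := by
    intro a b
    rw [hI, hI, hI, ← intervalIntegral.integral_sub
        ((continuous_coord_orbit T n a).intervalIntegrable _ _)
        ((continuous_coord_orbit T n b).intervalIntegrable _ _)]
    simp only [map_sub]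
  have hs := hp.surjective m
  -- The chosen preimages need not be additive, but `hest` is applied to their differences, whose
  -- coordinate `m` is `v - w`.
  let f : E m → E n := fun v => (δ : ℝ)⁻¹ • p n (I (Function.surjInv hs v))
  have hf : ApproximatesLinearOn f L Set.univ (R.nnnorm⁻¹ / 2) := by
    intro v _ w _
    have hv := Function.surjInv_eq hs v
    have hw := Function.surjInv_eq hs w
    have hd : p n (Function.surjInv hs v - Function.surjInv hs w) = L (v - w) := by
      rw [hL, map_sub (p m), hv, hw]
    have h1 : f v - f w - L (v - w) = (δ : ℝ)⁻¹ •
        (p n (I (Function.surjInv hs v - Function.surjInv hs w)) -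
          (δ : ℝ) • p n (Function.surjInv hs v - Function.surjInv hs w)) := by
      rw [hd, hIsub, smul_sub, inv_smul_smul₀ hδ0.ne', smul_sub]
    rw [h1, norm_smul, norm_inv, Real.norm_of_nonneg hδ0.le, inv_mul_le_iff₀ hδ0, mul_comm (δ : ℝ)]
    have h2 := hest (Function.surjInv hs v - Function.surjInv hs w)
    rwa [map_sub (p m), hv, hw] at h2
  obtain ⟨v, hv⟩ := hf.surjective_of_nonlinearRightInverse R (by
    have : (0 : ℝ) < (R.nnnorm : ℝ)⁻¹ := by positivity
    push_cast; linarith) ((δ : ℝ)⁻¹ • p n x)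
  have hv' := smul_right_injective (E n) (inv_ne_zero hδ0.ne') hv
  exact ⟨_, _, T.hasOrbitDeriv_integral hp (hI _), hv'⟩

end Integral

/-- An element of the domain agreeing with `x` in coordinate `m` has, by equicontinuity, the same
orbit in coordinate `n` for times up to `1`, hence the same difference quotients there. The
coordinate limits then glue. -/
theorem IsUniformlyCont.exists_hasOrbitDeriv [∀ n, CompleteSpace (E n)] [BaireSpace X]
    (hp : IsQuojection p) {T : StronglyContSemigroup 𝕜 X} (hT : T.IsUniformlyCont) (x : X) :
    ∃ y, T.HasOrbitDeriv x y := by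
  let _ : ∀ n, NormedSpace ℝ (E n) := fun n => NormedSpace.restrictScalars ℝ 𝕜 (E n)
  have _ : ∀ n, IsScalarTower ℝ 𝕜 (E n) := fun n => RestrictScalars.isScalarTower ℝ 𝕜 (E n)
  have hcoord : ∀ n, ∃ v, Tendsto (fun h : ℝ≥0 => p n ((((h : ℝ) : 𝕜))⁻¹ • (T.op h x - x)))
      (𝓝[>] 0) (𝓝 v) := by
    intro n
    obtain ⟨m, -, C, -, h⟩ := T.exists_orbit_bound hp n 0 1
    obtain ⟨y, y', hy, hyx⟩ := hT.exists_hasOrbitDeriv_coord_eq hp m x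
    have heq : ∀ s ≤ (1 : ℝ≥0), p n (T.op s y) = p n (T.op s x) := by
      intro s hs
      have := h s hs (y - x)
      rwa [map_sub (p m), hyx, sub_self, norm_zero, mul_zero, norm_le_zero_iff, map_sub, map_sub,
        sub_eq_zero] at this
    refine ⟨p n y', (hp.tendsto_iff.1 hy n).congr' ?_⟩
    have h1 : ∀ᶠ s : ℝ≥0 in 𝓝[>] 0, s ≤ 1 :=
      nhdsWithin_le_nhds (eventually_le_nhds (zero_lt_one (α := ℝ≥0)))
    filter_upwards [h1] with s hs
    have h0 := heq 0 zero_le_one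
    rw [T.op_zero] at h0
    simp only [ContinuousLinearMap.id_apply] at h0
    rw [map_smul, map_smul, map_sub, map_sub, heq s hs, h0]
  choose v hv using hcoord
  obtain ⟨y, hy⟩ := hp.glue v fun n m L hL => by
    have h1 := (L.continuous.tendsto _).comp (hv m)
    refine tendsto_nhds_unique h1 ((hv n).congr fun h => hL _)
  exact ⟨y, hp.tendsto_iff.2 fun n => by rw [hy]; exact hv n⟩

theorem IsUniformlyCont.exists_generator [∀ n, CompleteSpace (E n)] [BaireSpace X]
    [IsTopologicalAddGroup X] [ContinuousSMul 𝕜 X] [T2Space X]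
    (hp : IsQuojection p) {T : StronglyContSemigroup 𝕜 X} (hT : T.IsUniformlyCont) :
    ∃ A : X →L[𝕜] X, ∀ x, T.HasOrbitDeriv x (A x) := by
  choose A hA using hT.exists_hasOrbitDeriv hp
  let A' : X →ₗ[𝕜] X :=
    { toFun := A
      map_add' := fun x y => tendsto_nhds_unique (hA (x + y)) ((hA x).add (hA y))
      map_smul' := fun c x => tendsto_nhds_unique (hA (c • x)) ((hA x).smul c) }
  refine ⟨⟨A', hp.continuous_of_bound A' fun n => ?_⟩, hA⟩
  -- Along a sequence of times, convergent difference quotients are bounded, so Banach–Steinhaus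
  -- applies and its bound passes to the limit `A`.
  let h : ℕ → ℝ≥0 := fun j => 1 / ((j : ℝ≥0) + 1)
  have hh : Tendsto h atTop (𝓝[>] 0) := by
    refine tendsto_nhdsWithin_iff.2 ⟨tendsto_one_div_add_atTop_nhds_zero_nat,
      Eventually.of_forall fun j => ?_⟩
    show 0 < 1 / ((j : ℝ≥0) + 1)
    positivity
  have hlim : ∀ x, Tendsto (fun j => p n ((((h j : ℝ) : 𝕜))⁻¹ • (T.op (h j) x - x))) atTop
      (𝓝 (p n (A x))) := fun x => (hp.tendsto_iff.1 (hA x) n).comp hh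
  obtain ⟨m, -, C, -, hC⟩ := hp.banach_steinhaus
    (fun j => (p n).comp ((((h j : ℝ) : 𝕜))⁻¹ • (T.op (h j) - ContinuousLinearMap.id 𝕜 X)))
    (fun x => by
      obtain ⟨c, hc⟩ := (hlim x).norm.bddAbove_range
      exact ⟨c, fun j => hc ⟨j, rfl⟩⟩) 0
  exact ⟨m, C, fun x => le_of_tendsto (hlim x).norm (Eventually.of_forall fun j => hC j x)⟩

end StronglyContSemigroup

theorem theorem1 {𝕜 : Type*} [RCLike 𝕜]
    {E : ℕ → Type*} [∀ n, NormedAddCommGroup (E n)] [∀ n, NormedSpace 𝕜 (E n)]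
    [∀ n, CompleteSpace (E n)]
    (link : ∀ n m : ℕ, n ≤ m → (E m →L[𝕜] E n)) (hlink : IsStrictProjSystem link)
    {X : Type*} [AddCommGroup X] [Module 𝕜 X] [TopologicalSpace X]
    [IsTopologicalAddGroup X] [ContinuousSMul 𝕜 X] [T2Space X]
    (e : X ≃L[𝕜] projLim link) :
    (∀ T : StronglyContSemigroup 𝕜 X, T.IsUniformlyCont →
      ∃ A : X →L[𝕜] X, T.IsGeneratedBy A ∧
        ∀ (x : X) (t : ℝ≥0),
          HasSum (fun k : ℕ => (((t : ℝ) ^ k / (k ! : ℝ) : ℝ) : 𝕜) • (A ^ k) x) (T.op t x)) ∧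
    (∀ A : X →L[𝕜] X,
      ((∃ T : StronglyContSemigroup 𝕜 X, T.IsGeneratedBy A) ↔
        ∀ n : ℕ, ∃ m : ℕ, ∀ (k : ℕ) (x : X),
          (e x : ∀ i, E i) m = 0 → (e ((A ^ k) x) : ∀ i, E i) n = 0) ∧
      ∀ T : StronglyContSemigroup 𝕜 X, T.IsGeneratedBy A → T.IsUniformlyCont) := by
  have hp := hlink.isQuojection e
  have : BaireSpace X := baireSpace_of_projLim e
  simp only [← projLimCoord_apply, StronglyContSemigroup.isGeneratedBy_iff]
  refine ⟨fun T hT => ?_, fun A => ⟨⟨?_, fun h => ?_⟩, fun T hA => ?_⟩⟩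
  · obtain ⟨A, hA⟩ := hT.exists_generator hp
    exact ⟨A, hA, StronglyContSemigroup.hasSum_of_generator hp hA⟩
  · rintro ⟨T, hA⟩
    exact StronglyContSemigroup.exists_ker_le hp hA
  · exact hp.exists_semigroup (hp.exists_pow_bound h)
  · exact StronglyContSemigroup.isUniformlyCont_of_generator hp hA
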